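/- Let $s_1,\dots,s_n$ ($n\ge 1$) be vertical line segments of length $1$ in the Euclidean plane with pairwise distinct $x$-coordinates. A (feasible) tour is a cyclic sequence of points $p_1,\dots,p_k$ ($k\ge 1$, $p_{k+1}=p_1$), each lying on one of the segments, such that every segment contains at least one $p_j$; its legs are the straight line segments $p_jp_{j+1}$, and its length is $\sum_{j=1}^k\|p_jp_{j+1}\|$. An optimum tour is a tour of minimum length among all tours (with any number of points). The shadow of a tour at $x_0\in\mathbb R$ is the number of legs that meet the vertical line $x=x_0$, where a common end-point of two consecutive legs is attributed only to the leg that starts there (and legs of length $0$ are disregarded), while overlapping legs are counted separately; the shadow of the tour is the maximum of this number over all $x_0$. Theorem. Suppose that the minimal axis-parallel bounding box of $s_1,\dots,s_n$ has height $H\le 3$. Then every optimum tour has shadow at most $2$. Moreover, every vertical line meets the closed polygonal curve traced by an optimum tour in at most two points, and every optimum tour is bitonic: from a suitable starting point it runs strictly from left to right and then strictly from right to left back to its starting point (apart from possible repetitions of a point in consecutive positions of the sequence). -/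

import Mathlib

/-- The Euclidean plane; `q 0` and `q 1` are the `x`- and `y`-coordinates of `q`. -/
abbrev Plane : Type := EuclideanSpace ℝ (Fin 2)

/-- The vertical line `x = x₀`. -/
def verticalLine (x₀ : ℝ) : Set Plane := {q | q 0 = x₀}

/-- The vertical unit segment whose lower tip is `b`. -/
def unitSegment (b : Plane) : Set Plane := {q | q 0 = b 0 ∧ b 1 ≤ q 1 ∧ q 1 ≤ b 1 + 1}

/-- The height of the minimal axis-parallel bounding box of the vertical unit segments with
lower tips `b i`. -/
noncomputable def boxHeight {n : ℕ} (b : Fin n → Plane) : ℝ :=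
  sSup ((fun q : Plane => q 1) '' ⋃ i, unitSegment (b i)) -
    sInf ((fun q : Plane => q 1) '' ⋃ i, unitSegment (b i))

/-- A feasible tour of the segments with lower tips `b i`: a cyclic sequence of `k ≥ 1` points,
each of them on some segment, such that every segment carries at least one of them. -/
structure IsTour {n : ℕ} (b : Fin n → Plane) {k : ℕ} [NeZero k] (p : ZMod k → Plane) : Prop where
  mem_segment : ∀ j, ∃ i, p j ∈ unitSegment (b i)
  visits : ∀ i, ∃ j, p j ∈ unitSegment (b i)

/-- The length of the closed polygonal curve through the cyclic sequence `p`. -/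
noncomputable def tourLength {k : ℕ} [NeZero k] (p : ZMod k → Plane) : ℝ :=
  ∑ j : ZMod k, dist (p j) (p (j + 1))

/-- A feasible tour of minimum length among all feasible tours, with any number of points. -/
structure IsOptimalTour {n : ℕ} (b : Fin n → Plane) {k : ℕ} [NeZero k] (p : ZMod k → Plane) :
    Prop where
  isTour : IsTour b p
  length_le : ∀ (m : ℕ) [NeZero m] (q : ZMod m → Plane), IsTour b q → tourLength p ≤ tourLength q

/-- The `j`-th leg of the tour: the straight line from `p j` to `p (j + 1)`. -/
def leg {k : ℕ} (p : ZMod k → Plane) (j : ZMod k) : Set Plane :=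
  segment ℝ (p j) (p (j + 1))

/-- The closed curve, as a set of points, that the tour runs through. -/
def tourTrace {k : ℕ} (p : ZMod k → Plane) : Set Plane := ⋃ j, leg p j

/-- The shadow of the tour at `x₀`: the number of legs that meet the line `x = x₀`. A common
end-point of two consecutive legs is one visit of the tour, so it is attributed only to the leg
that starts there; in particular a straight point or break point contributes `1`, and a leg of
length zero contributes nothing. Legs that overlap are counted separately. -/
noncomputable def shadowAt {k : ℕ} (p : ZMod k → Plane) (x₀ : ℝ) : ℕ∞ :=
  {j : ZMod k | ((leg p j \ {p (j + 1)}) ∩ verticalLine x₀).Nonempty}.encard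

/-- The shadow of the tour: the maximum of its shadows at all vertical lines. -/
noncomputable def shadow {k : ℕ} (p : ZMod k → Plane) : ℕ∞ := ⨆ x₀ : ℝ, shadowAt p x₀

/-- A bitonic tour: starting from a suitable point, it first runs strictly from left to right, and
then strictly from right to left until it is back at its start. (Consecutive points of the
sequence may coincide.) -/
def IsBitonic {k : ℕ} (p : ZMod k → Plane) : Prop :=
  ∃ (l : ZMod k) (m : ℕ), m ≤ k ∧
    (∀ j : ℕ, j < m → p (l + j) = p (l + j + 1) ∨ p (l + j) 0 < p (l + j + 1) 0) ∧
    (∀ j : ℕ, m ≤ j → j < k → p (l + j) = p (l + j + 1) ∨ p (l + j + 1) 0 < p (l + j) 0)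

/-! Height at most 3 yields a horizontal strip of height 1 that meets every segment. Projecting the
vertices of a tour vertically onto it keeps the tour feasible and lengthens no leg, so an optimum
tour lies in the strip or on a horizontal line. Either way, for each segment the tour stays above
its lower tip or stays below its upper tip (`IsOptimalTour.side`).

At a vertex where the tour turns back horizontally, another leg meeting the same segment could take
over the visit, and dropping the vertex would be a gain. Hence the other legs pass the vertical line
of that vertex all above it or all below it (`IsOptimalTour.above_or_below`).

After removal of repetitions there are no vertical legs (`IsOptimalTour.cyc_zero_ne`). If the tour
is not bitonic, its lowest peak in the x-direction is flanked by peaks at least as high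
(`unimodal_or_zigzag`). Four consecutive monotone stretches then lie over the interval from the
higher adjacent valley to the lowest peak. The above/below alternatives at both ends of the interval
make two stretches of equal direction cross, and exchanging the two crossing legs shortens the tour
(`IsOptimalTour.not_zigzag_of_le`).

Both bounds follow from bitonicity, since each monotone half contributes at most one to either
count. -/

/-! ### Walks, assembled by concatenation and reversal -/

/-- The walks with vertices in `S`, recorded by their ends, their length and the set of their
vertices. -/
inductive Walk (S : Set Plane) : Plane → Plane → ℝ → Set Plane → Prop
  | nil {x : Plane} (hx : x ∈ S) : Walk S x x 0 {x}
  | cons {x y z : Plane} {L : ℝ} {V : Set Plane} (hx : x ∈ S) (h : Walk S y z L V) :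
      Walk S x z (dist x y + L) (insert x V)

namespace Walk

variable {S : Set Plane} {x y z : Plane} {L L' : ℝ} {V V' : Set Plane}

theorem left_mem (h : Walk S x y L V) : x ∈ S := by
  cases h <;> assumption

theorem left_mem_vertices (h : Walk S x y L V) : x ∈ V := by
  cases h <;> simp

theorem trans (h : Walk S x y L V) (h' : Walk S y z L' V') : Walk S x z (L + L') (V ∪ V') := by
  induction h with
  | nil hx =>
    have := h'.left_mem_vertices
    rwa [zero_add, Set.singleton_union, Set.insert_eq_of_mem this]
  | cons hx _ ih =>
    rw [add_assoc, Set.insert_union]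
    exact .cons hx (ih h')

theorem edge (hx : x ∈ S) (hy : y ∈ S) : Walk S x y (dist x y) {x, y} := by
  simpa using Walk.cons hx (.nil hy)

theorem symm (h : Walk S x y L V) : Walk S y x L V := by
  induction h with
  | nil hx => exact .nil hx
  | @cons x y z L V hx h ih =>
    have := ih.trans (edge h.left_mem hx)
    rwa [dist_comm, add_comm, Set.union_insert, Set.union_singleton, Set.insert_comm,
      Set.insert_eq_of_mem h.left_mem_vertices] at this

/-- A walk is given by the sequence of its vertices. -/
theorem exists_seq (h : Walk S x y L V) : ∃ (m : ℕ) (Q : ℕ → Plane), Q 0 = x ∧ Q m = y ∧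
    (∀ i, Q i ∈ S) ∧ L = ∑ i ∈ Finset.range m, dist (Q i) (Q (i + 1)) ∧
      ∀ v ∈ V, ∃ i ≤ m, Q i = v := by
  induction h with
  | @nil x hx => exact ⟨0, fun _ => x, rfl, rfl, fun _ => hx, by simp, by simp⟩
  | @cons x y z L V hx h ih =>
    obtain ⟨m, Q, h0, hm, hS, hL, hV⟩ := ih
    refine ⟨m + 1, fun i => Nat.casesOn i x Q, rfl, hm, fun i => ?_, ?_, ?_⟩
    · cases i
      exacts [hx, hS _]
    · rw [Finset.sum_range_succ', hL, ← h0, add_comm]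
      rfl
    · rintro v (rfl | hv)
      · exact ⟨0, Nat.zero_le _, rfl⟩
      · obtain ⟨i, hi, rfl⟩ := hV v hv
        exact ⟨i + 1, Nat.succ_le_succ hi, rfl⟩

end Walk

theorem tourLength_eq_sum_range {m : ℕ} (Q : ℕ → Plane) :
    tourLength (fun j : ZMod (m + 1) => Q j.val) =
      ∑ i ∈ Finset.range m, dist (Q i) (Q (i + 1)) + dist (Q m) (Q 0) := by
  have key : tourLength (fun j : ZMod (m + 1) => Q j.val) = ∑ i ∈ Finset.range (m + 1),
      dist (Q ((i : ZMod (m + 1))).val) (Q ((i : ZMod (m + 1)) + 1).val) :=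
    Finset.sum_nbij' (fun j => j.val) (fun i => (i : ZMod (m + 1)))
      (fun j _ => Finset.mem_range.2 (ZMod.val_lt j)) (fun _ _ => Finset.mem_univ _)
      (fun j _ => by simp) (fun i hi => ZMod.val_cast_of_lt (Finset.mem_range.1 hi))
      (fun j _ => by simp)
  rw [key, Finset.sum_range_succ]
  congr 1
  · refine Finset.sum_congr rfl fun i hi => ?_
    have hi := Finset.mem_range.1 hi
    have := ZMod.val_cast_of_lt (n := m + 1) (a := i + 1) (by omega)
    rw [ZMod.val_cast_of_lt (by omega), ← this]
    push_cast
    rfl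
  · rw [ZMod.val_cast_of_lt (by omega)]
    have : ((m : ZMod (m + 1)) + 1) = 0 := by exact_mod_cast ZMod.natCast_self (m + 1)
    rw [this, ZMod.val_zero]

/-! ### Tours as periodic sequences indexed by the integers -/

section Cyc

variable {n : ℕ} {b : Fin n → Plane} {k : ℕ} {p : ZMod k → Plane}

/-- The points of a tour, as a periodic sequence. -/
def cyc {k : ℕ} (p : ZMod k → Plane) (i : ℤ) : Plane := p i

theorem cyc_add_period (i : ℤ) : cyc p (i + k) = cyc p i := by simp [cyc]

theorem exists_cyc_eq [NeZero k] (s : ℤ) (j : ZMod k) : ∃ i : ℕ, i < k ∧ cyc p (s + i) = p j :=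
  ⟨(j - s).val, ZMod.val_lt _, by simp [cyc]⟩

/-- The length of the piece of `P` that starts at `P s` and has `m` legs. -/
noncomputable def arc (P : ℤ → Plane) (s : ℤ) (m : ℕ) : ℝ :=
  ∑ i ∈ Finset.range m, dist (P (s + i)) (P (s + i + 1))

theorem arc_add (P : ℤ → Plane) (s : ℤ) (m m' : ℕ) :
    arc P s (m + m') = arc P s m + arc P (s + m) m' := by
  simp only [arc, Finset.sum_range_add, Nat.cast_add, add_assoc]

theorem arc_one (P : ℤ → Plane) (s : ℤ) : arc P s 1 = dist (P s) (P (s + 1)) := by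
  simp [arc]

theorem tourLength_eq_arc [NeZero k] (s : ℤ) : tourLength p = arc (cyc p) s k :=
  Finset.sum_nbij' (fun j => (j - s : ZMod k).val) (fun i => (s + i : ZMod k))
    (fun j _ => Finset.mem_range.2 (ZMod.val_lt _)) (fun _ _ => Finset.mem_univ _)
    (fun j _ => by simp)
    (fun i hi => by simpa using ZMod.val_cast_of_lt (Finset.mem_range.1 hi))
    (fun j _ => by simp [cyc])

theorem walk_arc {S : Set Plane} {P : ℤ → Plane} (hP : ∀ i, P i ∈ S) (s : ℤ) (m : ℕ) :
    Walk S (P s) (P (s + m)) (arc P s m) {q | ∃ i : ℕ, i ≤ m ∧ P (s + i) = q} := by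
  induction m with
  | zero =>
    have : {q | ∃ i : ℕ, i ≤ 0 ∧ P (s + i) = q} = {P s} := by
      ext q; simp [eq_comm]
    rw [this]
    simpa [arc] using Walk.nil (hP s)
  | succ m ih =>
    have := ih.trans (Walk.edge (hP _) (hP (s + m + 1)))
    rw [arc_add, arc_one]
    convert this using 1
    · push_cast; rw [add_assoc]
    · ext q
      simp only [Set.mem_ofPred_eq, Set.mem_union, Set.mem_insert_iff, Set.mem_singleton_iff]
      constructor
      · rintro ⟨i, hi, rfl⟩
        rcases hi.eq_or_lt with rfl | hi
        · right; right; push_cast; rw [add_assoc]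
        · exact .inl ⟨i, by omega, rfl⟩
      · rintro (⟨i, hi, rfl⟩ | rfl | rfl)
        · exact ⟨i, by omega, rfl⟩
        · exact ⟨m, by omega, rfl⟩
        · exact ⟨m + 1, le_rfl, by push_cast; rw [add_assoc]⟩

/-- The union of the segments. -/
def carrier {n : ℕ} (b : Fin n → Plane) : Set Plane := ⋃ i, unitSegment (b i)

theorem mem_carrier {q : Plane} : q ∈ carrier b ↔ ∃ i, q ∈ unitSegment (b i) := Set.mem_iUnion

theorem IsTour.cyc_mem [NeZero k] (h : IsTour b p) (i : ℤ) : cyc p i ∈ carrier b :=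
  mem_carrier.2 (h.mem_segment _)

theorem IsOptimalTour.length_le_walk [NeZero k] (hp : IsOptimalTour b p) {x : Plane} {L : ℝ}
    {V : Set Plane} (h : Walk (carrier b) x x L V) (hV : ∀ i, ∃ q ∈ V, q ∈ unitSegment (b i)) :
    tourLength p ≤ L := by
  obtain ⟨m, Q, h0, hm, hS, rfl, hQ⟩ := h.exists_seq
  -- A closed walk lists its start twice, so the closing leg of this tour has length zero.
  have hle := hp.length_le (m + 1) (fun j : ZMod (m + 1) => Q j.val)
    ⟨fun j => mem_carrier.1 (hS _), fun i => ?_⟩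
  · rwa [tourLength_eq_sum_range, h0, hm, dist_self, add_zero] at hle
  · obtain ⟨q, hq, hqi⟩ := hV i
    obtain ⟨t, ht, rfl⟩ := hQ q hq
    exact ⟨t, by rwa [ZMod.val_cast_of_lt (by omega)]⟩

end Cyc

theorem cyc_reverse {k : ℕ} {p : ZMod k → Plane} (i : ℤ) :
    cyc (fun j => p (-j)) i = cyc p (-i) := by
  simp [cyc]

/-! ### Local modifications of a tour -/

section Surgery

variable {n : ℕ} {b : Fin n → Plane} {k : ℕ} [NeZero k] {p : ZMod k → Plane}

/-- The vertex `c` cannot be dropped with profit, if its segment is visited by another vertex. -/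
theorem IsOptimalTour.dist_add_dist_le_of_vertex (hp : IsOptimalTour b p)
    (hx : Function.Injective fun i => b i 0) {c j : ℤ} (hcj : c < j) (hjc : j < c + k)
    (h : cyc p j 0 = cyc p c 0) :
    dist (cyc p (c - 1)) (cyc p c) + dist (cyc p c) (cyc p (c + 1)) ≤
      dist (cyc p (c - 1)) (cyc p (c + 1)) := by
  obtain ⟨m, hm⟩ : ∃ m : ℕ, (k : ℤ) = m + 2 := ⟨k - 2, by omega⟩
  have hS := hp.isTour.cyc_mem
  have e1 : c - 1 + k = c + 1 + m := by omega
  have e2 : cyc p (c + 1 + m) = cyc p (c - 1) := by rw [← e1, cyc_add_period]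
  have w := (walk_arc hS (c + 1) m).trans (Walk.edge (hS _) (hS (c + 1)))
  have hl := hp.length_le_walk w fun i => ?_
  · have hk : k = 1 + m + 1 := by omega
    have hlen := (tourLength_eq_arc c).trans (congrArg (arc (cyc p) c) hk)
    rw [arc_add, arc_add, arc_one, arc_one] at hlen
    have e3 : c + ((1 + m : ℕ) : ℤ) = c + 1 + m := by push_cast; ring
    have e4 : cyc p (c + 1 + m + 1) = cyc p c := by
      rw [← cyc_add_period (p := p) c]; congr 1; omega
    rw [e3, e4] at hlen
    rw [e2] at hl hlen
    push_cast at hlen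
    linarith
  · obtain ⟨l, hl⟩ := hp.isTour.visits i
    obtain ⟨t, ht, htl⟩ := exists_cyc_eq (p := p) c l
    rw [← htl] at hl
    -- Only the visit paid by `c` itself is lost; by injectivity of the x-coordinates, vertex `j`
    -- lies on the same segment and replaces it.
    rcases Nat.eq_zero_or_pos t with rfl | ht0
    · refine ⟨cyc p j, .inl ⟨(j - c - 1).toNat, by omega, ?_⟩, ?_⟩
      · congr 1; omega
      · obtain ⟨i', hi'⟩ := mem_carrier.1 (hS j)
        have : i = i' := hx <| by
          have h1 := hl.1
          have h2 := hi'.1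
          simp only [Nat.cast_zero, add_zero] at h1
          simp only
          rw [← h1, ← h2, h]
        rwa [this]
    · exact ⟨_, .inl ⟨t - 1, by omega, by congr 1; omega⟩, hl⟩

/-- The vertex `c` cannot be dropped with profit, if another leg of the tour meets its segment. -/
theorem IsOptimalTour.dist_add_dist_le (hp : IsOptimalTour b p)
    (hx : Function.Injective fun i => b i 0) {c j : ℤ} (hcj : c < j) (hjc : j + 1 < c + k)
    {z : Plane} (hz : z ∈ segment ℝ (cyc p j) (cyc p (j + 1))) {i : Fin n}
    (hzi : z ∈ unitSegment (b i)) (hci : cyc p c ∈ unitSegment (b i)) :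
    dist (cyc p (c - 1)) (cyc p c) + dist (cyc p c) (cyc p (c + 1)) ≤
      dist (cyc p (c - 1)) (cyc p (c + 1)) := by
  obtain ⟨m, hm⟩ : ∃ m : ℕ, j = c + 1 + m := ⟨(j - c - 1).toNat, by omega⟩
  obtain ⟨m', hm'⟩ : ∃ m' : ℕ, (k : ℤ) = m + m' + 3 := ⟨(c + k - 2 - j).toNat, by omega⟩
  have hS := hp.isTour.cyc_mem
  have hzS : z ∈ carrier b := mem_carrier.2 ⟨i, hzi⟩
  have e1 : c - 1 + k = j + 1 + m' := by omega
  have e2 : cyc p (j + 1 + m') = cyc p (c - 1) := by rw [← e1, cyc_add_period]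
  -- The detour through `z` costs nothing, as `z` lies on leg `j`.
  have w := ((((walk_arc hS (c + 1) m).trans (Walk.edge (hS _) hzS)).trans
    (Walk.edge hzS (hS (j + 1)))).trans (walk_arc hS (j + 1) m')).trans
    (Walk.edge (hS _) (hS (c + 1)))
  have hl := hp.length_le_walk w fun i' => ?_
  · have hk : k = 1 + m + 1 + m' + 1 := by omega
    have hlen := (tourLength_eq_arc c).trans (congrArg (arc (cyc p) c) hk)
    rw [arc_add, arc_add, arc_add, arc_add, arc_one, arc_one, arc_one] at hlen
    have e3 : c + ((1 + m : ℕ) : ℤ) = j := by push_cast; omega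
    have e4 : c + ((1 + m + 1 : ℕ) : ℤ) = j + 1 := by push_cast; omega
    have e5 : c + ((1 + m + 1 + m' : ℕ) : ℤ) = j + 1 + m' := by push_cast; omega
    have e6 : cyc p (j + 1 + m' + 1) = cyc p c := by
      rw [← cyc_add_period (p := p) c]; congr 1; omega
    rw [e3, e4, e5, e6] at hlen
    rw [e2] at hl hlen
    rw [← hm] at hl
    push_cast at hlen
    have := dist_add_dist_of_mem_segment hz
    linarith
  · obtain ⟨l, hl⟩ := hp.isTour.visits i'
    obtain ⟨t, ht, htl⟩ := exists_cyc_eq (p := p) c l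
    rw [← htl] at hl
    rcases Nat.eq_zero_or_pos t with rfl | ht0
    · refine ⟨z, by simp, ?_⟩
      have : i = i' := hx <| by
        have h1 := hl.1
        have h2 := hci.1
        simp only [Nat.cast_zero, add_zero] at h1
        simp only
        rw [← h1, ← h2]
      rwa [← this]
    · by_cases htm : t ≤ m + 1
      · exact ⟨_, .inl (.inl (.inl (.inl ⟨t - 1, by omega, by congr 1; omega⟩))), hl⟩
      · exact ⟨_, .inl (.inr ⟨t - m - 2, by omega, by congr 1; omega⟩), hl⟩

/-- Two legs with a common point cannot be exchanged with profit for the connections of their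
starts and of their ends. -/
theorem IsOptimalTour.dist_add_dist_le_of_cross (hp : IsOptimalTour b p) {i j : ℤ} (hij : i < j)
    (hji : j < i + k) {z : Plane} (hzi : z ∈ segment ℝ (cyc p i) (cyc p (i + 1)))
    (hzj : z ∈ segment ℝ (cyc p j) (cyc p (j + 1))) :
    dist (cyc p (i + 1)) z + dist z (cyc p (j + 1)) ≤ dist (cyc p (i + 1)) (cyc p (j + 1)) := by
  obtain ⟨m, hm⟩ : ∃ m : ℕ, j = i + 1 + m := ⟨(j - i - 1).toNat, by omega⟩
  obtain ⟨m', hm'⟩ : ∃ m' : ℕ, (k : ℤ) = m + m' + 2 := ⟨(i + k - 1 - j).toNat, by omega⟩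
  have hS := hp.isTour.cyc_mem
  have e2 : cyc p (j + 1 + m') = cyc p i := by
    rw [← cyc_add_period (p := p) i]; congr 1; omega
  have w1 := (walk_arc hS (i + 1) m).symm
  have w2 := walk_arc hS (j + 1) m'
  rw [e2] at w2
  rw [← hm] at w1
  -- The arc from `i + 1` to `j` is traversed backwards; the two new edges join the ends and the
  -- starts of the exchanged legs.
  have w := ((w1.trans (Walk.edge (hS _) (hS (j + 1)))).trans w2).trans
    (Walk.edge (hS _) (hS j))
  have hl := hp.length_le_walk w fun i' => ?_
  · have hk : k = 1 + m + 1 + m' := by omega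
    have hlen := (tourLength_eq_arc i).trans (congrArg (arc (cyc p) i) hk)
    rw [arc_add, arc_add, arc_add, arc_one, arc_one] at hlen
    have e3 : i + ((1 + m : ℕ) : ℤ) = j := by push_cast; omega
    have e4 : i + ((1 + m + 1 : ℕ) : ℤ) = j + 1 := by push_cast; omega
    rw [e3, e4] at hlen
    push_cast at hlen
    have h1 := dist_add_dist_of_mem_segment hzi
    have h2 := dist_add_dist_of_mem_segment hzj
    have h3 := dist_triangle (cyc p i) z (cyc p j)
    have h4 := dist_comm z (cyc p j)
    have h5 := dist_comm z (cyc p (i + 1))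
    linarith
  · obtain ⟨l, hl⟩ := hp.isTour.visits i'
    obtain ⟨t, ht, htl⟩ := exists_cyc_eq (p := p) (i + 1) l
    rw [← htl] at hl
    by_cases htm : t ≤ m
    · exact ⟨_, .inl (.inl (.inl ⟨t, by omega, rfl⟩)), hl⟩
    · exact ⟨_, .inl (.inr ⟨t - m - 1, by omega, by congr 1; omega⟩), hl⟩

/-- The reversed tour is optimal, too. -/
theorem IsOptimalTour.reverse (hp : IsOptimalTour b p) : IsOptimalTour b fun j => p (-j) where
  isTour := ⟨fun j => hp.isTour.mem_segment _, fun i => by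
    obtain ⟨j, hj⟩ := hp.isTour.visits i
    exact ⟨-j, by rwa [neg_neg]⟩⟩
  length_le m _ q hq := by
    refine le_trans (le_of_eq ?_) (hp.length_le m q hq)
    refine Fintype.sum_equiv ((Equiv.neg _).trans (Equiv.subRight 1)) _ _ fun j => ?_
    simp [dist_comm, sub_eq_add_neg, add_comm]

end Surgery

/-! ### The strip of height 1 and the use of the height bound -/

theorem Plane.dist_eq (u v : Plane) : dist u v = √((u 0 - v 0) ^ 2 + (u 1 - v 1) ^ 2) := by
  simp [EuclideanSpace.dist_eq, Real.dist_eq, sq_abs]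

theorem Plane.ext {u v : Plane} (h0 : u 0 = v 0) (h1 : u 1 = v 1) : u = v := by
  ext i
  fin_cases i
  exacts [h0, h1]

theorem exists_lower_tip_bounds {n : ℕ} {b : Fin n → Plane} (hH : boxHeight b ≤ 3) :
    ∃ B : ℝ, ∀ i, B ≤ b i 1 ∧ b i 1 ≤ B + 2 := by
  set A : Set ℝ := (fun q : Plane => q 1) '' ⋃ i, unitSegment (b i) with hA
  obtain ⟨C, hC⟩ := (Set.finite_range fun i => b i 1).bddAbove
  obtain ⟨D, hD⟩ := (Set.finite_range fun i => b i 1).bddBelow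
  have hu : BddAbove A := ⟨C + 1, by
    rintro _ ⟨q, hq, rfl⟩
    obtain ⟨i, hi⟩ := Set.mem_iUnion.1 hq
    have := hC ⟨i, rfl⟩
    have := hi.2.2
    simp only at *
    linarith⟩
  have hl : BddBelow A := ⟨D, by
    rintro _ ⟨q, hq, rfl⟩
    obtain ⟨i, hi⟩ := Set.mem_iUnion.1 hq
    have := hD ⟨i, rfl⟩
    have := hi.2.1
    simp only at *
    linarith⟩
  refine ⟨sInf A, fun i => ?_⟩
  have h1 : b i 1 ∈ A := ⟨b i, Set.mem_iUnion.2 ⟨i, rfl, le_rfl, by linarith⟩, rfl⟩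
  have h2 : b i 1 + 1 ∈ A :=
    ⟨!₂[b i 0, b i 1 + 1], Set.mem_iUnion.2 ⟨i, by simp [unitSegment]⟩, by simp⟩
  have h3 := csInf_le hl h1
  have h4 := le_csSup hu h2
  have h5 : sSup A - sInf A ≤ 3 := hH
  constructor <;> linarith

/-- The projection of the real line onto `[B + 1, B + 2]`. -/
noncomputable def clip (B t : ℝ) : ℝ := max (B + 1) (min (B + 2) t)

theorem clip_sub_sq_le (B s t : ℝ) : (clip B s - clip B t) ^ 2 ≤ (s - t) ^ 2 := by
  refine sq_le_sq.2 ?_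
  have h1 := abs_max_sub_max_le_max (B + 1) (min (B + 2) s) (B + 1) (min (B + 2) t)
  have h2 := abs_min_sub_min_le_max (B + 2) s (B + 2) t
  simp only [sub_self, abs_zero, abs_nonneg, sup_of_le_right] at h1 h2
  exact h1.trans h2

/-- The projection strictly shortens the distance from a point outside the interval to any other
point; this is the equality case of `clip_sub_sq_le`. -/
theorem eq_of_clip_sub_sq_eq {B s t : ℝ} (h : (clip B s - clip B t) ^ 2 = (s - t) ^ 2)
    (ht : t < B + 1 ∨ B + 2 < t) : s = t := by
  rw [sq_eq_sq_iff_abs_eq_abs] at h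
  unfold clip at h
  rcases ht with ht | ht
  · rw [min_eq_right (by linarith : t ≤ B + 2), max_eq_left ht.le] at h
    rcases le_total s (B + 1) with hs | hs
    · rw [min_eq_right (by linarith), max_eq_left hs] at h
      have : |s - t| = 0 := by rw [← h]; simp
      linarith [abs_eq_zero.1 this]
    · rw [abs_of_nonneg (by simp), abs_of_nonneg (by linarith)] at h
      have : max (B + 1) (min (B + 2) s) ≤ s := max_le hs (min_le_right _ _)
      linarith
  · have e : max (B + 1) (B + 2) = B + 2 := max_eq_right (by linarith)
    rw [min_eq_left ht.le, e] at h
    rcases le_total (B + 2) s with hs | hs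
    · rw [min_eq_left hs, e] at h
      have : |s - t| = 0 := by rw [← h]; simp
      linarith [abs_eq_zero.1 this]
    · rw [min_eq_right hs] at h
      have h1 : s ≤ max (B + 1) s := le_max_right _ _
      have h2 : max (B + 1) s ≤ B + 2 := max_le (by linarith) hs
      rw [abs_of_nonpos (by linarith), abs_of_nonpos (by linarith)] at h
      linarith

/-- The y-range of the segment meets `[B + 1, B + 2]`, so moving a point of it to the nearest height
in that interval does not leave the segment. -/
theorem clip_mem_unitSegment {B : ℝ} {c q : Plane} (hB : B ≤ c 1 ∧ c 1 ≤ B + 2)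
    (hq : q ∈ unitSegment c) : !₂[q 0, clip B (q 1)] ∈ unitSegment c := by
  obtain ⟨h0, h1, h2⟩ := hq
  refine ⟨by simpa using h0, ?_, ?_⟩
  · simpa [clip] using Or.inr ⟨hB.2, h1⟩
  · simpa [clip] using ⟨hB.1, Or.inr h2⟩

/-- Either an optimal tour stays on a horizontal line, or it stays in a strip that separates the
upper from the lower segments. -/
theorem IsOptimalTour.side {n : ℕ} {b : Fin n → Plane} {k : ℕ} [NeZero k] {p : ZMod k → Plane}
    (hp : IsOptimalTour b p) {B : ℝ} (hB : ∀ i, B ≤ b i 1 ∧ b i 1 ≤ B + 2) (i : Fin n) :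
    (∀ j, b i 1 ≤ p j 1) ∨ ∀ j, p j 1 ≤ b i 1 + 1 := by
  set q : ZMod k → Plane := fun j => !₂[p j 0, clip B (p j 1)] with hq
  have hqt : IsTour b q := by
    refine ⟨fun j => ?_, fun i => ?_⟩
    · obtain ⟨i, hi⟩ := hp.isTour.mem_segment j
      exact ⟨i, clip_mem_unitSegment (hB i) hi⟩
    · obtain ⟨j, hj⟩ := hp.isTour.visits i
      exact ⟨j, clip_mem_unitSegment (hB i) hj⟩
  have hle : ∀ j ∈ Finset.univ, dist (q j) (q (j + 1)) ≤ dist (p j) (p (j + 1)) := by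
    intro j _
    rw [Plane.dist_eq, Plane.dist_eq]
    refine Real.sqrt_le_sqrt (add_le_add (by simp [q]) ?_)
    simpa [q] using clip_sub_sq_le B (p j 1) (p (j + 1) 1)
  have heq : ∀ j, dist (q j) (q (j + 1)) = dist (p j) (p (j + 1)) := fun j =>
    (Finset.sum_eq_sum_iff_of_le hle).1 (le_antisymm (Finset.sum_le_sum hle)
      (hp.length_le k q hqt)) j (Finset.mem_univ j)
  by_cases hstrip : ∀ j, B + 1 ≤ p j 1 ∧ p j 1 ≤ B + 2
  · rcases le_total (b i 1) (B + 1) with h | h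
    · exact .inl fun j => h.trans (hstrip j).1
    · exact .inr fun j => (hstrip j).2.trans (by linarith)
  · push Not at hstrip
    obtain ⟨j₀, hj₀⟩ := hstrip
    have hout : p j₀ 1 < B + 1 ∨ B + 2 < p j₀ 1 := by
      by_contra! h
      exact absurd (hj₀ h.1) (not_lt.2 h.2)
    -- The equality case of clipping passes the height of a vertex outside the strip on to its
    -- predecessor, and so around the whole tour.
    have hstep : ∀ m : ℕ, p (j₀ - m) 1 = p j₀ 1 := by
      intro m
      induction m with
      | zero => simp
      | succ m ih =>
        rw [← ih] at hout ⊢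
        have h := heq (j₀ - (m + 1 : ℕ))
        have e : j₀ - ((m + 1 : ℕ) : ZMod k) + 1 = j₀ - m := by push_cast; ring
        rw [e, Plane.dist_eq, Plane.dist_eq, Real.sqrt_inj (by positivity) (by positivity)] at h
        refine eq_of_clip_sub_sq_eq (B := B) ?_ hout
        simpa [q] using h
    obtain ⟨j, hj⟩ := hp.isTour.visits i
    have hconst : ∀ j', p j' 1 = p j₀ 1 := fun j' => by
      have := hstep (j₀ - j').val
      simpa using this
    refine .inl fun j' => ?_
    rw [hconst j', ← hconst j]
    exact hj.2.1

/-! ### Peaks and valleys of periodic sequences -/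

section Combinatorics

variable {X : ℤ → ℝ}

/-- `e` is the first ascent after `c`; without an interior peak, the ascent cannot stop before `d`.
-/
theorem exists_valley {c d : ℤ} (hcd : c < d) (hc : X (c + 1) < X c) (hd : X (d - 1) < X d)
    (hX : ∀ i, X i ≠ X (i + 1)) (hpeak : ∀ i, c < i → i < d → ¬ (X (i - 1) < X i ∧ X (i + 1) < X i)) :
    ∃ e, c < e ∧ e < d ∧ (∀ i, c ≤ i → i < e → X (i + 1) < X i) ∧
      ∀ i, e ≤ i → i < d → X i < X (i + 1) := by
  obtain ⟨e, ⟨hce, he⟩, hmin⟩ := Int.exists_least_of_bdd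
    (P := fun e => c ≤ e ∧ X e < X (e + 1)) ⟨c, fun _ h => h.1⟩
    ⟨d - 1, by omega, by rwa [sub_add_cancel]⟩
  have hed : e ≤ d - 1 := hmin _ ⟨by omega, by rwa [sub_add_cancel]⟩
  have hce' : c ≠ e := by
    rintro rfl
    exact lt_asymm hc he
  refine ⟨e, by omega, by omega, fun i hi hie => ?_, fun i hi => ?_⟩
  · by_contra h
    have := hmin i ⟨hi, lt_of_le_of_ne (not_lt.1 h) (hX i)⟩
    omega
  · induction i, hi using Int.leInduction with
    | base => exact fun _ => he
    | succ i hi ih =>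
      intro hid
      refine lt_of_le_of_ne (not_lt.1 fun h => ?_) (hX _)
      exact hpeak (i + 1) (by omega) hid ⟨by simpa using ih (by omega), h⟩

/-- A periodic sequence without repetitions in consecutive positions either goes up and down once
in a period, or has two peaks, one of which is flanked by peaks that are at least as high. -/
theorem unimodal_or_zigzag {k : ℕ} [NeZero k] {Y : ZMod k → ℝ} (hX : ∀ i : ℤ, X i = Y i)
    (hne : ∀ i, X i ≠ X (i + 1)) :
    (∃ e f : ℤ, e ≤ f ∧ f ≤ e + k ∧ (∀ i, e ≤ i → i < f → X i < X (i + 1)) ∧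
      ∀ i, f ≤ i → i < e + k → X (i + 1) < X i) ∨
    ∃ a c₁ c₂ c₃ d : ℤ, a < c₁ ∧ c₁ < c₂ ∧ c₂ < c₃ ∧ c₃ < d ∧ d ≤ a + k ∧ X c₂ ≤ X a ∧ X c₂ ≤ X d ∧
      (∀ i, a ≤ i → i < c₁ → X (i + 1) < X i) ∧ (∀ i, c₁ ≤ i → i < c₂ → X i < X (i + 1)) ∧
      (∀ i, c₂ ≤ i → i < c₃ → X (i + 1) < X i) ∧ ∀ i, c₃ ≤ i → i < d → X i < X (i + 1) := by
  have hper : ∀ i, X (i + k) = X i := fun i => by simp [hX]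
  have hk : 0 < k := Nat.pos_of_ne_zero (NeZero.ne k)
  let peak : ℤ → Prop := fun i => X (i - 1) < X i ∧ X (i + 1) < X i
  have hpeak : ∀ i, peak (i + k) ↔ peak i := fun i => by
    have h1 : i + k - 1 = i - 1 + k := by ring
    have h2 : i + k + 1 = i + 1 + k := by ring
    simp only [peak, h1, h2, hper]
  obtain ⟨c₂, hc₂, hmin⟩ : ∃ c, peak c ∧ ∀ i, peak i → X c ≤ X i := by
    have hne' : {j : ZMod k | ∃ i : ℤ, i = j ∧ peak i}.Nonempty := by
      obtain ⟨j, hj⟩ := Finite.exists_max Y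
      have hmax : ∀ i : ℤ, X i ≤ X j.val := fun i => by simpa [hX] using hj i
      refine ⟨j, j.val, by simp, lt_of_le_of_ne (hmax _) ?_, lt_of_le_of_ne (hmax _) (hne _).symm⟩
      have := hne ((j.val : ℤ) - 1)
      rwa [sub_add_cancel] at this
    obtain ⟨j, ⟨i, rfl, hi⟩, hj⟩ := Set.exists_min_image _ Y (Set.toFinite _) hne'
    exact ⟨i, hi, fun i' hi' => by simpa [hX] using hj _ ⟨i', rfl, hi'⟩⟩
  obtain ⟨d, ⟨hcd, hd⟩, hdmin⟩ := Int.exists_least_of_bdd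
    (P := fun d => c₂ < d ∧ peak d) ⟨c₂, fun _ h => h.1.le⟩
    ⟨c₂ + k, by omega, (hpeak _).2 hc₂⟩
  obtain ⟨a, ⟨hac, ha⟩, hamax⟩ := Int.exists_greatest_of_bdd
    (P := fun a => a < c₂ ∧ peak a) ⟨c₂, fun _ h => h.1.le⟩
    ⟨c₂ - k, by omega, by rw [← hpeak, sub_add_cancel]; exact hc₂⟩
  have hdk : d ≤ c₂ + k := hdmin _ ⟨by omega, (hpeak _).2 hc₂⟩
  obtain ⟨c₃, h1, h2, h3, h4⟩ := exists_valley hcd hc₂.2 hd.1 hne fun i hi hid h => by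
    have := hdmin i ⟨hi, h⟩
    omega
  -- If the next peak is `c₂ + k`, there is one peak per period.
  rcases hdk.eq_or_lt with rfl | hdk
  · refine .inl ⟨c₃, c₂ + k, h2.le, by omega, h4, fun i hi hi' => ?_⟩
    have := h3 (i - k) (by omega) (by omega)
    rw [← hper (i - k), ← hper (i - k + 1)] at this
    convert this using 2 <;> ring
  · have hda : d - k ≤ a := hamax _ ⟨by omega, by rwa [← hpeak, sub_add_cancel]⟩
    obtain ⟨c₁, h5, h6, h7, h8⟩ := exists_valley hac ha.2 hc₂.1 hne fun i hi hid h => by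
      have := hamax i ⟨hid, h⟩
      omega
    exact .inr ⟨a, c₁, c₂, c₃, d, h5, h6, h1, h2, by omega, hmin a ha, hmin d hd, h7, h8, h3, h4⟩

/-- Discrete intermediate values on an ascending stretch. -/
theorem exists_le_lt_of_ascending {s t : ℤ} (hst : s ≤ t) {x : ℝ} (hs : X s ≤ x) (ht : x < X t) :
    ∃ i, s ≤ i ∧ i < t ∧ X i ≤ x ∧ x < X (i + 1) := by
  induction t, hst using Int.leInduction with
  | base => exact absurd hs (not_le.2 ht)
  | succ t hst ih =>
    by_cases h : x < X t
    · obtain ⟨i, h1, h2, h3⟩ := ih h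
      exact ⟨i, h1, by omega, h3⟩
    · exact ⟨t, hst, by omega, not_lt.1 h, ht⟩

theorem exists_lt_le_of_ascending {s t : ℤ} (hst : s ≤ t) {x : ℝ} (hs : X s < x) (ht : x ≤ X t) :
    ∃ i, s ≤ i ∧ i < t ∧ X i < x ∧ x ≤ X (i + 1) := by
  induction t, hst using Int.leInduction with
  | base => exact absurd hs (not_lt.2 ht)
  | succ t hst ih =>
    by_cases h : x ≤ X t
    · obtain ⟨i, h1, h2, h3⟩ := ih h
      exact ⟨i, h1, by omega, h3⟩
    · exact ⟨t, hst, by omega, not_le.1 h, ht⟩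

theorem exists_lt_le_of_descending {s t : ℤ} (hst : s ≤ t) {x : ℝ} (hs : x ≤ X s) (ht : X t < x) :
    ∃ i, s ≤ i ∧ i < t ∧ X (i + 1) < x ∧ x ≤ X i := by
  obtain ⟨i, h1, h2, h3, h4⟩ := exists_le_lt_of_ascending (X := fun i => -X i) hst (x := -x)
    (by simpa using hs) (by simpa using ht)
  exact ⟨i, h1, h2, by simpa using h4, by simpa using h3⟩

theorem exists_le_lt_of_descending {s t : ℤ} (hst : s ≤ t) {x : ℝ} (hs : x < X s) (ht : X t ≤ x) :
    ∃ i, s ≤ i ∧ i < t ∧ X (i + 1) ≤ x ∧ x < X i := by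
  obtain ⟨i, h1, h2, h3, h4⟩ := exists_lt_le_of_ascending (X := fun i => -X i) hst (x := -x)
    (by simpa using hs) (by simpa using ht)
  exact ⟨i, h1, h2, by simpa using h4, by simpa using h3⟩

end Combinatorics

/-! ### Monotone stretches as graphs of continuous functions -/

section Strands

theorem Plane.mem_segment_coords {u v z : Plane} (hz : z ∈ segment ℝ u v) :
    ∃ t : ℝ, 0 ≤ t ∧ t ≤ 1 ∧ ∀ i, z i = (1 - t) * u i + t * v i := by
  obtain ⟨s, t, hs, ht, hst, rfl⟩ := hz
  refine ⟨t, ht, by linarith, fun i => ?_⟩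
  rw [← hst]
  simp

theorem Plane.exists_mem_segment {u v : Plane} {x : ℝ} (hu : u 0 ≤ x) (hv : x ≤ v 0) :
    ∃ z ∈ segment ℝ u v, z 0 = x := by
  rcases (hu.trans hv).eq_or_lt with h | h
  · exact ⟨u, left_mem_segment ℝ u v, by linarith⟩
  · have h' : 0 < v 0 - u 0 := sub_pos.2 h
    refine ⟨AffineMap.lineMap u v ((x - u 0) / (v 0 - u 0)), ?_, ?_⟩
    · rw [segment_eq_image_lineMap]
      exact ⟨_, ⟨div_nonneg (by linarith) h'.le, (div_le_one h').2 (by linarith)⟩, rfl⟩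
    · simp [AffineMap.lineMap_apply]
      field_simp
      ring

/-- A stretch of a polygonal line that runs from left to right is the graph of a function. -/
theorem exists_graph_of_ascending {P : ℤ → Plane} {s t : ℤ} (hst : s ≤ t)
    (h : ∀ i, s ≤ i → i < t → P i 0 < P (i + 1) 0) :
    ∃ f : ℝ → ℝ, Continuous f ∧ f (P t 0) = P t 1 ∧
      ∀ i, s ≤ i → i < t → ∀ z ∈ segment ℝ (P i) (P (i + 1)), z 0 ≤ P t 0 ∧ f (z 0) = z 1 := by
  induction t, hst using Int.leInduction with
  | base => exact ⟨fun _ => P s 1, continuous_const, rfl, fun i h1 h2 => by omega⟩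
  | succ t hst ih =>
    obtain ⟨f, hf, hft, hfi⟩ := ih fun i h1 h2 => h i h1 (by omega)
    have hlt := h t hst (by omega)
    have hpos : 0 < P (t + 1) 0 - P t 0 := sub_pos.2 hlt
    let g : ℝ → ℝ := fun x =>
      P t 1 + (x - P t 0) * ((P (t + 1) 1 - P t 1) / (P (t + 1) 0 - P t 0))
    have hleg : ∀ z ∈ segment ℝ (P t) (P (t + 1)),
        P t 0 ≤ z 0 ∧ z 0 ≤ P (t + 1) 0 ∧ g (z 0) = z 1 := by
      intro z hz
      obtain ⟨r, h0, h1, hr⟩ := Plane.mem_segment_coords hz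
      refine ⟨by rw [hr]; nlinarith, by rw [hr]; nlinarith, ?_⟩
      simp only [g, hr]
      field_simp
      ring
    have hfg : ∀ x, P t 0 ≤ x → (if x ≤ P t 0 then f x else g x) = g x := by
      intro x hx
      split_ifs with h'
      · obtain rfl := le_antisymm hx h'
        simp [hft, g]
      · rfl
    -- Earlier legs lie to the left of `P t`, so they see only the branch `f`; the bound on `z 0` is
    -- carried through the induction for this purpose.
    refine ⟨fun x => if x ≤ P t 0 then f x else g x,
      hf.if_le (by fun_prop) continuous_id continuous_const ?_, ?_, fun i h1 h2 z hz => ?_⟩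
    · rintro _ rfl
      simp [hft, g]
    · simpa only [hfg _ hlt.le] using (hleg _ (right_mem_segment ℝ _ _)).2.2
    · rcases (Int.lt_add_one_iff.1 h2).eq_or_lt with rfl | h2
      · have := hleg z hz
        exact ⟨this.2.1, by simpa only [hfg _ this.1] using this.2.2⟩
      · have := hfi i h1 h2 z hz
        exact ⟨this.1.trans hlt.le, by simpa only [if_pos this.1] using this.2⟩

theorem exists_graph_of_descending {P : ℤ → Plane} {s t : ℤ} (hst : s ≤ t)
    (h : ∀ i, s ≤ i → i < t → P (i + 1) 0 < P i 0) :
    ∃ f : ℝ → ℝ, Continuous f ∧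
      ∀ i, s ≤ i → i < t → ∀ z ∈ segment ℝ (P i) (P (i + 1)), f (z 0) = z 1 := by
  obtain ⟨f, hf, -, hfi⟩ := exists_graph_of_ascending (P := fun i => P (-i)) (s := -t) (t := -s)
    (by omega) fun i h1 h2 => by
      have := h (-(i + 1)) (by omega) (by omega)
      have e : -(i + 1) + 1 = -i := by ring
      rwa [e] at this
  refine ⟨f, hf, fun i h1 h2 z hz => (hfi (-(i + 1)) (by omega) (by omega) z ?_).2⟩
  rw [segment_symm]
  convert hz using 2
  · simp
  · congr 1; ring

end Strands

/-! ### Excluding vertical legs and zigzags -/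

section Core

variable {n : ℕ} {b : Fin n → Plane} {k : ℕ} [NeZero k] {p : ZMod k → Plane}

/-- An optimal tour without repetitions in consecutive positions has no vertical legs. -/
theorem IsOptimalTour.cyc_zero_ne (hp : IsOptimalTour b p)
    (hx : Function.Injective fun i => b i 0) (hne : ∀ j, p j ≠ p (j + 1)) (i : ℤ) :
    cyc p i 0 ≠ cyc p (i + 1) 0 := by
  intro hi
  have hne' : ∀ i, cyc p i ≠ cyc p (i + 1) := fun i => by simpa [cyc] using hne i
  have hk : 1 < k := by
    by_contra h
    have h1 : k = 1 := by have := NeZero.ne k; omega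
    subst h1
    exact hne 0 (congrArg p (Subsingleton.elim _ _))
  -- A highest end-point of a vertical leg: it cannot be dropped with profit, so it lies strictly
  -- between its neighbours, both on its vertical line and neither above it.
  obtain ⟨j, hj, hmax⟩ := Set.exists_max_image
    {j : ZMod k | p j 0 = p (j + 1) 0 ∨ p j 0 = p (j - 1) 0} (fun j => p j 1) (Set.toFinite _)
    ⟨i, .inl (by simpa [cyc] using hi)⟩
  set c : ℤ := (j.val : ℤ) with hc
  have hcj : ((c : ℤ) : ZMod k) = j := by simp [hc]
  have hmax' : ∀ i : ℤ, cyc p i 0 = cyc p (i + 1) 0 ∨ cyc p i 0 = cyc p (i - 1) 0 →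
      cyc p i 1 ≤ cyc p c 1 := by
    intro i hi
    have := hmax i (by simpa [cyc] using hi)
    simpa [cyc, hcj] using this
  have hj' : cyc p (c + 1) 0 = cyc p c 0 ∨ cyc p (c - 1) 0 = cyc p c 0 := by
    simpa [cyc, hcj, eq_comm] using hj
  have hle : dist (cyc p (c - 1)) (cyc p c) + dist (cyc p c) (cyc p (c + 1)) ≤
      dist (cyc p (c - 1)) (cyc p (c + 1)) := by
    rcases hj' with h | h
    · exact hp.dist_add_dist_le_of_vertex hx (j := c + 1) (by omega) (by omega) h
    · refine hp.dist_add_dist_le_of_vertex hx (j := c - 1 + k) (by omega) (by omega) ?_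
      rwa [cyc_add_period]
  have hmem : cyc p c ∈ segment ℝ (cyc p (c - 1)) (cyc p (c + 1)) := by
    rw [mem_segment_iff_wbtw, ← dist_add_dist_eq_iff]
    exact le_antisymm hle (dist_triangle _ _ _)
  obtain ⟨t, h0, h1, ht⟩ := Plane.mem_segment_coords hmem
  have e0 := ht 0
  have e1 := ht 1
  have n1 := hne' (c - 1)
  have n2 := hne' c
  rw [sub_add_cancel] at n1
  have ht0 : t ≠ 0 := by
    rintro rfl
    exact n1 (Plane.ext (by linarith) (by linarith)).symm
  have ht1 : t ≠ 1 := by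
    rintro rfl
    exact n2 (Plane.ext (by linarith) (by linarith))
  have ht0 : 0 < t := lt_of_le_of_ne h0 ht0.symm
  have ht1 : 0 < 1 - t := sub_pos.2 (lt_of_le_of_ne h1 ht1)
  have f0 : cyc p (c + 1) 0 = cyc p c 0 ∧ cyc p (c - 1) 0 = cyc p c 0 := by
    rcases hj' with h | h
    · refine ⟨h, ?_⟩
      have : (1 - t) * (cyc p (c - 1) 0 - cyc p c 0) = 0 := by rw [h] at e0; linarith
      linarith [(mul_eq_zero.1 this).resolve_left ht1.ne']
    · refine ⟨?_, h⟩
      have : t * (cyc p (c + 1) 0 - cyc p c 0) = 0 := by rw [h] at e0; linarith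
      linarith [(mul_eq_zero.1 this).resolve_left ht0.ne']
  have g1 := hmax' (c + 1) (.inr (by rw [add_sub_cancel_right]; exact f0.1))
  have g2 := hmax' (c - 1) (.inl (by rw [sub_add_cancel]; exact f0.2))
  have : cyc p (c + 1) 1 = cyc p c 1 := by nlinarith
  exact n2 (Plane.ext f0.1.symm this.symm)

/-- If the tour turns back at a vertex, then the other legs of the tour pass its vertical line all
above it or all below it. -/
theorem IsOptimalTour.above_or_below (hp : IsOptimalTour b p)
    (hx : Function.Injective fun i => b i 0)
    (hside : ∀ i, (∀ j, b i 1 ≤ p j 1) ∨ ∀ j, p j 1 ≤ b i 1 + 1) {c : ℤ}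
    (hc : dist (cyc p (c - 1)) (cyc p (c + 1)) <
      dist (cyc p (c - 1)) (cyc p c) + dist (cyc p c) (cyc p (c + 1))) :
    (∀ j, c < j → j + 1 < c + k → ∀ z ∈ segment ℝ (cyc p j) (cyc p (j + 1)), z 0 = cyc p c 0 →
      cyc p c 1 < z 1) ∨
    (∀ j, c < j → j + 1 < c + k → ∀ z ∈ segment ℝ (cyc p j) (cyc p (j + 1)), z 0 = cyc p c 0 →
      z 1 < cyc p c 1) := by
  obtain ⟨i, hi⟩ := hp.isTour.mem_segment c
  change cyc p c ∈ _ at hi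
  have hz : ∀ j, c < j → j + 1 < c + k → ∀ z ∈ segment ℝ (cyc p j) (cyc p (j + 1)),
      z 0 = cyc p c 0 → ¬ (b i 1 ≤ z 1 ∧ z 1 ≤ b i 1 + 1) := fun j h1 h2 z hz h0 h =>
    absurd (hp.dist_add_dist_le hx h1 h2 hz ⟨h0.trans hi.1, h⟩ hi) (not_le.2 hc)
  rcases hside i with h | h
  · refine .inl fun j h1 h2 z hzj h0 => ?_
    have hb : b i 1 ≤ z 1 := by
      obtain ⟨t, t0, t1, ht⟩ := Plane.mem_segment_coords hzj
      have g1 : b i 1 ≤ cyc p j 1 := h _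
      have g2 : b i 1 ≤ cyc p (j + 1) 1 := h _
      rw [ht]
      nlinarith
    have := hz j h1 h2 z hzj h0
    have := hi.2.2
    by_contra! hlt
    exact hz j h1 h2 z hzj h0 ⟨hb, hlt.trans this⟩
  · refine .inr fun j h1 h2 z hzj h0 => ?_
    have hb : z 1 ≤ b i 1 + 1 := by
      obtain ⟨t, t0, t1, ht⟩ := Plane.mem_segment_coords hzj
      have g1 : cyc p j 1 ≤ b i 1 + 1 := h _
      have g2 : cyc p (j + 1) 1 ≤ b i 1 + 1 := h _
      rw [ht]
      nlinarith
    have := hi.2.1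
    by_contra! hlt
    exact hz j h1 h2 z hzj h0 ⟨this.trans hlt, hb⟩

/-- Equality would put `w` between `u` and `v`, although it lies strictly to the right of both. -/
theorem Plane.dist_lt_of_zero_lt {u v w : Plane} (hu : u 0 < w 0) (hv : v 0 < w 0) :
    dist u v < dist u w + dist w v := by
  refine lt_of_le_of_ne (dist_triangle _ _ _) fun h => ?_
  obtain ⟨t, h0, h1, ht⟩ := Plane.mem_segment_coords (mem_segment_iff_wbtw.2 (dist_add_dist_eq_iff.1 h.symm))
  have := ht 0
  rcases h0.eq_or_lt with rfl | h0 <;> nlinarith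

theorem Plane.dist_lt_of_lt_zero {u v w : Plane} (hu : w 0 < u 0) (hv : w 0 < v 0) :
    dist u v < dist u w + dist w v := by
  refine lt_of_le_of_ne (dist_triangle _ _ _) fun h => ?_
  obtain ⟨t, h0, h1, ht⟩ := Plane.mem_segment_coords (mem_segment_iff_wbtw.2 (dist_add_dist_eq_iff.1 h.symm))
  have := ht 0
  rcases h0.eq_or_lt with rfl | h0 <;> nlinarith

theorem exists_mem_Ioo_eq {f g : ℝ → ℝ} (hf : Continuous f) (hg : Continuous g) {u w : ℝ}
    (huw : u < w) (h : (f u < g u ∧ g w < f w) ∨ (g u < f u ∧ f w < g w)) :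
    ∃ x, u < x ∧ x < w ∧ f x = g x := by
  rcases h with h | h
  · obtain ⟨x, hx, h0⟩ := intermediate_value_Ioo huw.le (hf.sub hg).continuousOn
      (show (0 : ℝ) ∈ Set.Ioo _ _ from ⟨by simpa using h.1, by simpa using h.2⟩)
    exact ⟨x, hx.1, hx.2, sub_eq_zero.1 h0⟩
  · obtain ⟨x, hx, h0⟩ := intermediate_value_Ioo' huw.le (hf.sub hg).continuousOn
      (show (0 : ℝ) ∈ Set.Ioo _ _ from ⟨by simpa using h.2, by simpa using h.1⟩)
    exact ⟨x, hx.1, hx.2, sub_eq_zero.1 h0⟩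

theorem lt_of_forall_descending {X : ℤ → ℝ} {s t : ℤ} (hst : s < t)
    (h : ∀ i, s ≤ i → i < t → X (i + 1) < X i) : X t < X s := by
  induction t, (show s + 1 ≤ t from hst) using Int.leInduction with
  | base => exact h s le_rfl (by omega)
  | succ t hst' ih =>
    exact (h t (by omega) (by omega)).trans (ih (by omega) fun i h1 h2 => h i h1 (by omega))

/-- The zigzag that `unimodal_or_zigzag` provides contradicts optimality: its first or third
stretch must cross the stretch that runs in the same direction. -/
theorem IsOptimalTour.not_zigzag_of_le (hp : IsOptimalTour b p)
    (hx : Function.Injective fun i => b i 0)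
    (hside : ∀ i, (∀ j, b i 1 ≤ p j 1) ∨ ∀ j, p j 1 ≤ b i 1 + 1)
    {a c₁ c₂ c₃ d : ℤ} (h1 : a < c₁) (h2 : c₁ < c₂) (h3 : c₂ < c₃) (h4 : c₃ < d) (hda : d ≤ a + k)
    (ha : cyc p c₂ 0 ≤ cyc p a 0) (hd : cyc p c₂ 0 ≤ cyc p d 0)
    (s1 : ∀ i, a ≤ i → i < c₁ → cyc p (i + 1) 0 < cyc p i 0)
    (s2 : ∀ i, c₁ ≤ i → i < c₂ → cyc p i 0 < cyc p (i + 1) 0)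
    (s3 : ∀ i, c₂ ≤ i → i < c₃ → cyc p (i + 1) 0 < cyc p i 0)
    (s4 : ∀ i, c₃ ≤ i → i < d → cyc p i 0 < cyc p (i + 1) 0)
    (hc : cyc p c₁ 0 ≤ cyc p c₃ 0) : False := by
  have hlt : cyc p c₃ 0 < cyc p c₂ 0 :=
    lt_of_forall_descending (X := fun i => cyc p i 0) h3 s3
  obtain ⟨f₁, hf₁, F₁⟩ := exists_graph_of_descending (P := cyc p) h1.le s1
  obtain ⟨f₂, hf₂, -, F₂⟩ := exists_graph_of_ascending (P := cyc p) h2.le s2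
  obtain ⟨f₃, hf₃, F₃⟩ := exists_graph_of_descending (P := cyc p) h3.le s3
  obtain ⟨f₄, hf₄, -, F₄⟩ := exists_graph_of_ascending (P := cyc p) h4.le s4
  -- the values of the four functions at the two turning points
  have v3c : f₃ (cyc p c₃ 0) = cyc p c₃ 1 :=
    F₃ (c₃ - 1) (by omega) (by omega) _ (by rw [sub_add_cancel]; exact right_mem_segment ℝ _ _)
  have v3r : f₃ (cyc p c₂ 0) = cyc p c₂ 1 :=
    F₃ c₂ le_rfl h3 _ (left_mem_segment ℝ _ _)
  have v2r : f₂ (cyc p c₂ 0) = cyc p c₂ 1 :=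
    (F₂ (c₂ - 1) (by omega) (by omega) _
      (by rw [sub_add_cancel]; exact right_mem_segment ℝ _ _)).2
  have v4c : f₄ (cyc p c₃ 0) = cyc p c₃ 1 := (F₄ c₃ le_rfl h4 _ (left_mem_segment ℝ _ _)).2
  obtain ⟨i, i1, i2, i3, i4⟩ := exists_le_lt_of_descending (X := fun i => cyc p i 0) h1.le
    (hlt.trans_le ha) hc
  obtain ⟨z1c, m1c, x1c⟩ := Plane.exists_mem_segment i3 i4.le
  rw [segment_symm] at m1c
  have w1c := F₁ i i1 i2 _ m1c
  rw [x1c] at w1c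
  obtain ⟨i', i1', i2', i3', i4'⟩ := exists_lt_le_of_descending (X := fun i => cyc p i 0) h1.le
    ha (hc.trans_lt hlt)
  obtain ⟨z1r, m1r, x1r⟩ := Plane.exists_mem_segment i3'.le i4'
  rw [segment_symm] at m1r
  have w1r := F₁ i' i1' i2' _ m1r
  rw [x1r] at w1r
  obtain ⟨l, l1, l2, l3, l4⟩ := exists_le_lt_of_ascending (X := fun i => cyc p i 0) h2.le hc hlt
  obtain ⟨z2c, m2c, x2c⟩ := Plane.exists_mem_segment l3 l4.le
  have w2c := (F₂ l l1 l2 _ m2c).2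
  rw [x2c] at w2c
  obtain ⟨l', l1', l2', l3', l4'⟩ := exists_lt_le_of_ascending (X := fun i => cyc p i 0) h4.le
    hlt hd
  obtain ⟨z4r, m4r, x4r⟩ := Plane.exists_mem_segment l3'.le l4'
  have w4r := (F₄ l' l1' l2' _ m4r).2
  rw [x4r] at w4r
  -- `above_or_below` speaks of legs after the turning vertex, so earlier legs are moved by one
  -- period.
  have shift : ∀ {i : ℤ} {z : Plane}, z ∈ segment ℝ (cyc p i) (cyc p (i + 1)) →
      z ∈ segment ℝ (cyc p (i + k)) (cyc p (i + k + 1)) := fun {i z} h => by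
    rwa [cyc_add_period, add_right_comm, cyc_add_period]
  -- two stretches that run in the same direction do not meet
  have no13 : ¬ ∃ x, cyc p c₃ 0 < x ∧ x < cyc p c₂ 0 ∧ f₁ x = f₃ x := by
    rintro ⟨x, hx1, hx2, hx⟩
    obtain ⟨i, i1, i2, i3, i4⟩ := exists_lt_le_of_descending (X := fun i => cyc p i 0) h1.le
      (hx2.le.trans ha) (hc.trans_lt hx1)
    obtain ⟨j, j1, j2, j3, j4⟩ := exists_lt_le_of_descending (X := fun i => cyc p i 0) h3.le
      hx2.le hx1
    obtain ⟨z, mz, z0⟩ := Plane.exists_mem_segment i3.le i4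
    obtain ⟨z', mz', z0'⟩ := Plane.exists_mem_segment j3.le j4
    rw [segment_symm] at mz mz'
    have hz := F₁ i i1 i2 z mz
    have hz' := F₃ j j1 j2 z' mz'
    obtain rfl : z = z' := Plane.ext (z0.trans z0'.symm) (by rw [← hz, ← hz', z0, z0', hx])
    -- Both legs end strictly to the left of the crossing point, so joining their ends is strictly
    -- shorter.
    exact absurd (hp.dist_add_dist_le_of_cross (by omega) (by omega) mz mz')
      (not_le.2 (Plane.dist_lt_of_zero_lt (by rwa [z0]) (by rwa [z0])))
  have no24 : ¬ ∃ x, cyc p c₃ 0 < x ∧ x < cyc p c₂ 0 ∧ f₂ x = f₄ x := by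
    rintro ⟨x, hx1, hx2, hx⟩
    obtain ⟨i, i1, i2, i3, i4⟩ := exists_le_lt_of_ascending (X := fun i => cyc p i 0) h2.le
      (hc.trans hx1.le) hx2
    obtain ⟨j, j1, j2, j3, j4⟩ := exists_le_lt_of_ascending (X := fun i => cyc p i 0) h4.le
      hx1.le (hx2.trans_le hd)
    obtain ⟨z, mz, z0⟩ := Plane.exists_mem_segment i3 i4.le
    obtain ⟨z', mz', z0'⟩ := Plane.exists_mem_segment j3 j4.le
    have hz := (F₂ i i1 i2 z mz).2
    have hz' := (F₄ j j1 j2 z' mz').2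
    obtain rfl : z = z' := Plane.ext (z0.trans z0'.symm) (by rw [← hz, ← hz', z0, z0', hx])
    exact absurd (hp.dist_add_dist_le_of_cross (by omega) (by omega) mz mz')
      (not_le.2 (Plane.dist_lt_of_lt_zero (by rwa [z0]) (by rwa [z0])))
  have t2 := hp.above_or_below hx hside (c := c₂) (Plane.dist_lt_of_zero_lt
    (by simpa using s2 (c₂ - 1) (by omega) (by omega)) (s3 c₂ le_rfl h3))
  have t3 := hp.above_or_below hx hside (c := c₃) (Plane.dist_lt_of_lt_zero
    (by simpa using s3 (c₃ - 1) (by omega) (by omega)) (s4 c₃ le_rfl h4))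
  -- Stretches 2 and 3 meet at `c₂`, stretches 3 and 4 at `c₃`. Equal sides at the two turns make
  -- `f₂ - f₄` change sign; opposite sides make `f₁ - f₃` do so.
  rcases t2 with t2 | t2 <;> rcases t3 with t3 | t3
  all_goals
    have a1 := t3 (i + k) (by omega) (by omega) _ (shift m1c) x1c
    have a2 := t3 (l + k) (by omega) (by omega) _ (shift m2c) x2c
    have a3 := t2 (i' + k) (by omega) (by omega) _ (shift m1r) x1r
    have a4 := t2 l' (by omega) (by omega) _ m4r x4r
    rw [← w1c, ← v3c] at a1
    rw [← w2c, ← v4c] at a2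
    rw [← w1r, ← v3r] at a3
    rw [← w4r, ← v2r] at a4
  · exact no24 (exists_mem_Ioo_eq hf₂ hf₄ hlt (.inr ⟨a2, a4⟩))
  · exact no13 (exists_mem_Ioo_eq hf₁ hf₃ hlt (.inl ⟨a1, a3⟩))
  · exact no13 (exists_mem_Ioo_eq hf₁ hf₃ hlt (.inr ⟨a1, a3⟩))
  · exact no24 (exists_mem_Ioo_eq hf₂ hf₄ hlt (.inl ⟨a2, a4⟩))

/-- Reversing the tour exchanges the two valleys, so either may be assumed to be the higher one. -/
theorem IsOptimalTour.not_zigzag (hp : IsOptimalTour b p)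
    (hx : Function.Injective fun i => b i 0)
    (hside : ∀ i, (∀ j, b i 1 ≤ p j 1) ∨ ∀ j, p j 1 ≤ b i 1 + 1)
    {a c₁ c₂ c₃ d : ℤ} (h1 : a < c₁) (h2 : c₁ < c₂) (h3 : c₂ < c₃) (h4 : c₃ < d) (hda : d ≤ a + k)
    (ha : cyc p c₂ 0 ≤ cyc p a 0) (hd : cyc p c₂ 0 ≤ cyc p d 0)
    (s1 : ∀ i, a ≤ i → i < c₁ → cyc p (i + 1) 0 < cyc p i 0)
    (s2 : ∀ i, c₁ ≤ i → i < c₂ → cyc p i 0 < cyc p (i + 1) 0)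
    (s3 : ∀ i, c₂ ≤ i → i < c₃ → cyc p (i + 1) 0 < cyc p i 0)
    (s4 : ∀ i, c₃ ≤ i → i < d → cyc p i 0 < cyc p (i + 1) 0) : False := by
  rcases le_total (cyc p c₁ 0) (cyc p c₃ 0) with hc | hc
  · exact hp.not_zigzag_of_le hx hside h1 h2 h3 h4 hda ha hd s1 s2 s3 s4 hc
  · have flip : ∀ {R : ℝ → ℝ → Prop} {s t : ℤ}, (∀ i, s ≤ i → i < t →
        R (cyc p i 0) (cyc p (i + 1) 0)) → ∀ i, -t ≤ i → i < -s →
        R (cyc (fun j => p (-j)) (i + 1) 0) (cyc (fun j => p (-j)) i 0) := by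
      intro R s t h i hi hi'
      have := h (-(i + 1)) (by omega) (by omega)
      have e : -(i + 1) + 1 = -i := by ring
      rwa [cyc_reverse, cyc_reverse, ← e]
    refine hp.reverse.not_zigzag_of_le hx (fun i => (hside i).imp (fun h j => h _) fun h j => h _)
      (neg_lt_neg h4) (neg_lt_neg h3) (neg_lt_neg h2) (neg_lt_neg h1) (by omega) ?_ ?_
      (flip (R := fun x y => x < y) s4) (flip (R := fun x y => y < x) s3)
      (flip (R := fun x y => x < y) s2) (flip (R := fun x y => y < x) s1) ?_ <;>
    simpa [cyc_reverse]

theorem IsOptimalTour.isBitonic_of_ne (hp : IsOptimalTour b p)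
    (hx : Function.Injective fun i => b i 0)
    (hside : ∀ i, (∀ j, b i 1 ≤ p j 1) ∨ ∀ j, p j 1 ≤ b i 1 + 1)
    (hne : ∀ j, p j ≠ p (j + 1)) : IsBitonic p := by
  rcases unimodal_or_zigzag (X := fun i => cyc p i 0) (Y := fun j => p j 0) (fun _ => rfl)
    (hp.cyc_zero_ne hx hne) with ⟨e, f, hef, hfe, hu, hd⟩ |
      ⟨a, c₁, c₂, c₃, d, h1, h2, h3, h4, hda, ha, hd, s1, s2, s3, s4⟩
  · refine ⟨e, (f - e).toNat, by omega, fun j hj => .inr ?_, fun j hj hjk => .inr ?_⟩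
    · simpa [cyc] using hu (e + j) (by omega) (by omega)
    · simpa [cyc] using hd (e + j) (by omega) (by omega)
  · exact (hp.not_zigzag hx hside h1 h2 h3 h4 hda ha hd s1 s2 s3 s4).elim

end Core

/-! ### Removing and restoring repeated points -/

section Repetitions

variable {n : ℕ} {b : Fin n → Plane}

/-- A repetition in consecutive positions can be removed from an optimal tour. -/
theorem IsOptimalTour.remove_repetition {k : ℕ} {p : ZMod (k + 2) → Plane}
    (hp : IsOptimalTour b p) {j : ZMod (k + 2)} (hj : p j = p (j + 1)) :
    IsOptimalTour b fun i : ZMod (k + 1) => p (j + 1 + (i.val : ZMod (k + 2))) where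
  isTour := by
    refine ⟨fun i => hp.isTour.mem_segment _, fun i => ?_⟩
    obtain ⟨l, hl⟩ := hp.isTour.visits i
    have hlt := ZMod.val_lt (l - j - 1)
    rcases (Nat.lt_succ_iff.1 hlt).eq_or_lt with h | h
    · refine ⟨0, ?_⟩
      have e : l - j - 1 = ((k + 1 : ℕ) : ZMod (k + 2)) := by rw [← h]; simp
      have e' : ((k + 1 : ℕ) : ZMod (k + 2)) + 1 = 0 := by
        exact_mod_cast ZMod.natCast_self (k + 2)
      have : l = j := by linear_combination e + e'
      rw [this, hj] at hl
      simpa using hl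
    · refine ⟨((l - j - 1).val : ZMod (k + 1)), ?_⟩
      rw [ZMod.val_cast_of_lt h, ZMod.natCast_zmod_val]
      convert hl using 2
      ring
  length_le m _ q hq := by
    refine le_trans (le_of_eq ?_) (hp.length_le m q hq)
    -- The new closing leg runs from `p (j - 1)` to `p (j + 1) = p j`, and so replaces the old leg
    -- into `p j`.
    have hlast : j + 1 + (k : ZMod (k + 2)) + 1 = j := by
      have : ((k + 2 : ℕ) : ZMod (k + 2)) = 0 := ZMod.natCast_self (k + 2)
      push_cast at this
      linear_combination this
    rw [tourLength_eq_sum_range fun i : ℕ => p (j + 1 + (i : ZMod (k + 2))),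
      tourLength_eq_arc (((j + 1).val : ℕ) : ℤ), arc, Finset.sum_range_succ, Finset.sum_range_succ]
    simp [cyc, ← add_assoc, hlast, hj]

theorem IsBitonic.of_remove_repetition {k : ℕ} {p : ZMod (k + 2) → Plane} {j : ZMod (k + 2)}
    (hj : p j = p (j + 1))
    (h : IsBitonic fun i : ZMod (k + 1) => p (j + 1 + (i.val : ZMod (k + 2)))) : IsBitonic p := by
  obtain ⟨l, m, hm, hu, hd⟩ := h
  set q : ZMod (k + 1) → Plane := fun i => p (j + 1 + (i.val : ZMod (k + 2))) with hq
  have hl := ZMod.val_lt l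
  -- From `l`, the shorter tour reaches the doubled point after `T` legs; there the leg of length
  -- zero is inserted.
  obtain ⟨T, hT⟩ : ∃ T, l.val + T = k + 1 := ⟨k + 1 - l.val, by omega⟩
  have hcast : ((k + 2 : ℕ) : ZMod (k + 2)) = 0 := ZMod.natCast_self (k + 2)
  have hcast' : ((k + 1 : ℕ) : ZMod (k + 1)) = 0 := ZMod.natCast_self (k + 1)
  have hval : ∀ i : ℕ, l + (i : ZMod (k + 1)) = ((l.val + i : ℕ) : ZMod (k + 1)) := by simp
  set L : ZMod (k + 2) := j + 1 + (l.val : ZMod (k + 2)) with hL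
  have hT' : L + (T : ZMod (k + 2)) = j := by
    have := congrArg (Nat.cast : ℕ → ZMod (k + 2)) hT
    push_cast at this hcast
    linear_combination this + hcast
  have before : ∀ i : ℕ, i ≤ T → p (L + i) = q (l + i) := by
    intro i hi
    rcases hi.eq_or_lt with rfl | hi
    · rw [hT', hval, hT, hcast', hj]
      simp [q]
    · simp only [q, hval]
      rw [ZMod.val_cast_of_lt (by omega), hL]
      push_cast
      rw [add_assoc]
  have after : ∀ i : ℕ, T ≤ i → i ≤ k + 1 → p (L + (i + 1 : ℕ)) = q (l + i) := by
    intro i hi hik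
    obtain ⟨r, rfl⟩ := Nat.exists_eq_add_of_le hi
    have e : l + ((T + r : ℕ) : ZMod (k + 1)) = (r : ZMod (k + 1)) := by
      rw [hval, ← add_assoc, hT, Nat.cast_add, hcast', zero_add]
    simp only [q, e]
    rw [ZMod.val_cast_of_lt (by omega)]
    congr 1
    push_cast
    linear_combination hT'
  have stay : p (L + T) = p (L + (T + 1 : ℕ)) := by
    rw [before T le_rfl, after T le_rfl (by omega)]
  simp only [add_assoc, ← Nat.cast_add_one] at hu hd
  -- The inserted leg belongs to the descending half if `m ≤ T`, and otherwise lengthens the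
  -- ascending half by one.
  refine ⟨L, if m ≤ T then m else m + 1, by split_ifs <;> omega, fun i hi => ?_, fun i hi hik => ?_⟩
  all_goals
    rw [add_assoc L, ← Nat.cast_add_one]
    rcases lt_trichotomy i T with h | rfl | h
    · rw [before i h.le, before (i + 1) h]
      first
      | exact hu i (by split_ifs at hi <;> omega)
      | exact hd i (by split_ifs at hi <;> omega) (by omega)
    · exact .inl stay
    · obtain ⟨i, rfl⟩ := Nat.exists_eq_add_one_of_ne_zero (by omega : i ≠ 0)
      rw [after i (by omega) (by split_ifs at hi <;> omega),
        after (i + 1) (by omega) (by split_ifs at hi <;> omega)]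
      first
      | exact hu i (by split_ifs at hi <;> omega)
      | exact hd i (by split_ifs at hi <;> omega) (by omega)

theorem IsOptimalTour.isBitonic (hx : Function.Injective fun i => b i 0) {B : ℝ}
    (hB : ∀ i, B ≤ b i 1 ∧ b i 1 ≤ B + 2) :
    ∀ (k : ℕ) (p : ZMod (k + 1) → Plane), IsOptimalTour b p → IsBitonic p
  | 0, p, _ => ⟨0, 0, Nat.zero_le _, fun _ h => absurd h (Nat.not_lt_zero _),
      fun _ _ _ => .inl (congrArg p (Subsingleton.elim (α := Fin 1) _ _))⟩
  | k + 1, p, hp => by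
    by_cases h : ∃ j, p j = p (j + 1)
    · obtain ⟨j, hj⟩ := h
      exact .of_remove_repetition hj (isBitonic hx hB k _ (hp.remove_repetition hj))
    · push Not at h
      exact hp.isBitonic_of_ne hx (hp.side hB) h

end Repetitions

/-! ### Counting intersections of a bitonic tour with a vertical line -/

section Bitonic

/-- `v` is reached from `u` by going strictly to the right, or by staying in place. -/
def RightOrStay (u v : Plane) : Prop := u = v ∨ u 0 < v 0

theorem RightOrStay.trans {u v w : Plane} (h : RightOrStay u v) (h' : RightOrStay v w) :
    RightOrStay u w := by
  rcases h with rfl | h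
  · exact h'
  · rcases h' with rfl | h'
    exacts [.inr h, .inr (h.trans h')]

theorem RightOrStay.le {u v : Plane} (h : RightOrStay u v) : u 0 ≤ v 0 := by
  rcases h with rfl | h
  exacts [le_rfl, h.le]

theorem RightOrStay.eq {u v : Plane} (h : RightOrStay u v) (h0 : v 0 ≤ u 0) : u = v :=
  h.resolve_right (not_lt.2 h0)

theorem RightOrStay.of_mem_segment {u v z : Plane} (h : RightOrStay u v)
    (hz : z ∈ segment ℝ u v) : RightOrStay u z ∧ RightOrStay z v := by
  rcases h with rfl | h
  · rw [segment_same, Set.mem_singleton_iff] at hz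
    exact ⟨.inl hz.symm, .inl hz⟩
  · obtain ⟨t, h0, h1, ht⟩ := Plane.mem_segment_coords hz
    have hz0 := ht 0
    constructor
    · rcases h0.eq_or_lt with rfl | h0
      · exact .inl (Plane.ext (by simp [ht]) (by simp [ht]))
      · exact .inr (by nlinarith)
    · rcases h1.eq_or_lt with rfl | h1
      · exact .inl (Plane.ext (by simp [ht]) (by simp [ht]))
      · exact .inr (by nlinarith)

theorem RightOrStay.eq_of_mem_segment {u v z z' : Plane} (h : RightOrStay u v)
    (hz : z ∈ segment ℝ u v) (hz' : z' ∈ segment ℝ u v) (h0 : z 0 = z' 0) : z = z' := by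
  rcases h with rfl | h
  · rw [segment_same, Set.mem_singleton_iff] at hz hz'
    rw [hz, hz']
  · obtain ⟨t, -, -, ht⟩ := Plane.mem_segment_coords hz
    obtain ⟨t', -, -, ht'⟩ := Plane.mem_segment_coords hz'
    have : (t - t') * (v 0 - u 0) = 0 := by
      have := ht 0
      have := ht' 0
      linarith
    have : t = t' := sub_eq_zero.1 ((mul_eq_zero.1 this).resolve_right (sub_pos.2 h).ne')
    subst this
    exact Plane.ext h0 ((ht 1).trans (ht' 1).symm)

variable {Q : ℕ → Plane} {s t : ℕ}

theorem rightOrStay_of_le (h : ∀ i, s ≤ i → i < t → RightOrStay (Q i) (Q (i + 1))) {i j : ℕ}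
    (hi : s ≤ i) (hij : i ≤ j) (hj : j ≤ t) : RightOrStay (Q i) (Q j) := by
  induction j, hij using Nat.le_induction with
  | base => exact .inl rfl
  | succ j hij ih => exact (ih (by omega)).trans (h j (by omega) (by omega))

theorem leftOrStay_of_le (h : ∀ i, s ≤ i → i < t → RightOrStay (Q (i + 1)) (Q i)) {i j : ℕ}
    (hi : s ≤ i) (hij : i ≤ j) (hj : j ≤ t) : RightOrStay (Q j) (Q i) := by
  induction j, hij using Nat.le_induction with
  | base => exact .inl rfl
  | succ j hij ih => exact (h j (by omega) (by omega)).trans (ih (by omega))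

/-- The shape of a bitonic tour, in terms of the sequence of its points. -/
theorem IsBitonic.exists_seq {k : ℕ} [NeZero k] {p : ZMod k → Plane} (h : IsBitonic p) :
    ∃ (Q : ℕ → Plane) (l : ZMod k) (m : ℕ), m ≤ k ∧
      (∀ i, 0 ≤ i → i < m → RightOrStay (Q i) (Q (i + 1))) ∧
      (∀ i, m ≤ i → i < k → RightOrStay (Q (i + 1)) (Q i)) ∧
      (∀ i : ℕ, p (l + i) = Q i ∧ p (l + i + 1) = Q (i + 1)) ∧
      ∀ j : ZMod k, ∃ i : ℕ, i < k ∧ j = l + i := by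
  obtain ⟨l, m, hm, hu, hd⟩ := h
  refine ⟨fun i => p (l + i), l, m, hm, fun i _ hi => ?_, fun i hi hk => ?_, fun i => ?_,
    fun j => ⟨(j - l).val, ZMod.val_lt _, by simp⟩⟩
  · simpa [RightOrStay, add_assoc] using hu i hi
  · simpa [RightOrStay, add_assoc, eq_comm] using hd i hi hk
  · simp [add_assoc]

theorem IsBitonic.shadow_le {k : ℕ} [NeZero k] {p : ZMod k → Plane} (h : IsBitonic p) :
    shadow p ≤ 2 := by
  obtain ⟨Q, l, m, hm, hu, hd, hQ, hl⟩ := h.exists_seq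
  refine iSup_le fun x₀ => ?_
  let A (s t : ℕ) : Set (ZMod k) := {j | ∃ i : ℕ, s ≤ i ∧ i < t ∧ j = l + i ∧
    ∃ z ∈ segment ℝ (Q i) (Q (i + 1)), z ≠ Q (i + 1) ∧ z 0 = x₀}
  have hsub : {j : ZMod k | ((leg p j \ {p (j + 1)}) ∩ verticalLine x₀).Nonempty} ⊆
      A 0 m ∪ A m k := by
    rintro j ⟨z, ⟨hz, hne⟩, hz0⟩
    obtain ⟨i, hi, rfl⟩ := hl j
    rw [leg, (hQ i).1, (hQ i).2] at hz
    rw [(hQ i).2] at hne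
    rcases lt_or_ge i m with him | him
    · exact .inl ⟨i, Nat.zero_le _, him, rfl, z, hz, hne, hz0⟩
    · exact .inr ⟨i, him, hi, rfl, z, hz, hne, hz0⟩
  -- If two legs of one half meet the line, the earlier one does so only at its end, which the
  -- shadow does not attribute to it.
  have hone : ∀ s t, (∀ i i', s ≤ i → i < i' → i' < t →
      ∀ z ∈ segment ℝ (Q i) (Q (i + 1)), ∀ z' ∈ segment ℝ (Q i') (Q (i' + 1)),
        z 0 = z' 0 → z = Q (i + 1)) → (A s t).encard ≤ 1 := by
    intro s t h
    rw [Set.encard_le_one_iff]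
    rintro _ _ ⟨i, h1, h2, rfl, z, hz, hne, h0⟩ ⟨i', h1', h2', rfl, z', hz', hne', h0'⟩
    rcases lt_trichotomy i i' with hlt | rfl | hlt
    · exact absurd (h i i' h1 hlt h2' z hz z' hz' (h0.trans h0'.symm)) hne
    · rfl
    · exact absurd (h i' i h1' hlt h2 z' hz' z hz (h0'.trans h0.symm)) hne'
  refine (Set.encard_le_encard hsub).trans ((Set.encard_union_le _ _).trans ?_)
  rw [← one_add_one_eq_two]
  refine add_le_add (hone _ _ fun i i' h1 h2 h3 z hz z' hz' h0 => ?_)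
    (hone _ _ fun i i' h1 h2 h3 z hz z' hz' h0 => ?_)
  · have g := rightOrStay_of_le hu (Nat.zero_le (i + 1)) h2 h3.le
    have g' := ((hu i' (by omega) h3).of_mem_segment hz').1
    exact ((hu i h1 (by omega)).of_mem_segment hz).2.eq (by linarith [(g.trans g').le])
  · have g := leftOrStay_of_le hd (by omega : m ≤ i + 1) h2 h3.le
    rw [segment_symm] at hz hz'
    have g' := ((hd i' (by omega) h3).of_mem_segment hz').2
    exact (((hd i h1 (by omega)).of_mem_segment hz).1.eq (by linarith [(g'.trans g).le])).symm

theorem IsBitonic.encard_trace_le {k : ℕ} [NeZero k] {p : ZMod k → Plane} (h : IsBitonic p)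
    (x₀ : ℝ) : (tourTrace p ∩ verticalLine x₀).encard ≤ 2 := by
  obtain ⟨Q, l, m, hm, hu, hd, hQ, hl⟩ := h.exists_seq
  let A (s t : ℕ) : Set Plane := {z | ∃ i : ℕ, s ≤ i ∧ i < t ∧
    z ∈ segment ℝ (Q i) (Q (i + 1)) ∧ z 0 = x₀}
  have hsub : tourTrace p ∩ verticalLine x₀ ⊆ A 0 m ∪ A m k := by
    rintro z ⟨hz, hz0⟩
    obtain ⟨j, hz⟩ := Set.mem_iUnion.1 hz
    obtain ⟨i, hi, rfl⟩ := hl j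
    rw [leg, (hQ i).1, (hQ i).2] at hz
    rcases lt_or_ge i m with him | him
    · exact .inl ⟨i, Nat.zero_le _, him, hz, hz0⟩
    · exact .inr ⟨i, him, hi, hz, hz0⟩
  -- Here points are counted instead of legs, so the case of one leg meeting the line twice is
  -- included.
  have hone : ∀ s t, (∀ i i', s ≤ i → i ≤ i' → i' < t →
      ∀ z ∈ segment ℝ (Q i) (Q (i + 1)), ∀ z' ∈ segment ℝ (Q i') (Q (i' + 1)),
        z 0 = z' 0 → z = z') → (A s t).encard ≤ 1 := by
    intro s t h
    rw [Set.encard_le_one_iff]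
    rintro z z' ⟨i, h1, h2, hz, h0⟩ ⟨i', h1', h2', hz', h0'⟩
    rcases le_total i i' with hle | hle
    · exact h i i' h1 hle h2' z hz z' hz' (h0.trans h0'.symm)
    · exact (h i' i h1' hle h2 z' hz' z hz (h0'.trans h0.symm)).symm
  refine (Set.encard_le_encard hsub).trans ((Set.encard_union_le _ _).trans ?_)
  rw [← one_add_one_eq_two]
  refine add_le_add (hone _ _ fun i i' h1 h2 h3 z hz z' hz' h0 => ?_)
    (hone _ _ fun i i' h1 h2 h3 z hz z' hz' h0 => ?_)
  · rcases h2.eq_or_lt with rfl | h2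
    · exact (hu i h1 h3).eq_of_mem_segment hz hz' h0
    · have g := rightOrStay_of_le hu (Nat.zero_le (i + 1)) h2 h3.le
      have g' := ((hu i' (by omega) h3).of_mem_segment hz').1
      exact ((((hu i h1 (by omega)).of_mem_segment hz).2.trans g).trans g').eq h0.ge
  · rw [segment_symm] at hz hz'
    rcases h2.eq_or_lt with rfl | h2
    · exact (hd i h1 h3).eq_of_mem_segment hz hz' h0
    · have g := leftOrStay_of_le hd (by omega : m ≤ i + 1) h2 h3.le
      have g' := ((hd i' (by omega) h3).of_mem_segment hz').2
      exact (((g'.trans g).trans ((hd i h1 (by omega)).of_mem_segment hz).1).eq h0.le).symm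

end Bitonic

theorem mainTheorem4 {n : ℕ} (b : Fin n → Plane)
    (hx : Function.Injective fun i => b i 0)
    (hH : boxHeight b ≤ 3)
    {k : ℕ} [NeZero k] (p : ZMod k → Plane) (hp : IsOptimalTour b p) :
    shadow p ≤ 2 ∧
      (∀ x₀ : ℝ, (tourTrace p ∩ verticalLine x₀).encard ≤ 2) ∧
      IsBitonic p := by
  obtain ⟨B, hB⟩ := exists_lower_tip_bounds hH
  obtain ⟨k, rfl⟩ := Nat.exists_eq_add_one_of_ne_zero (NeZero.ne k)
  have h : IsBitonic p := IsOptimalTour.isBitonic hx hB k p hp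
  exact ⟨h.shadow_le, h.encard_trace_le, h⟩
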